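/- Theorem 4.3. There is a function $g:\mathbb{R}^5\to(0,\infty)$ with the following property. Let $H$ be a real or complex Hilbert space of finite dimension $n$, and let $(f_i)_{i=1}^k$ be a frame for $H$ with frame bounds $A,B>0$, that is, $$A\|x\|^2\le\sum_{i=1}^k|\langle x,f_i\rangle|^2\le B\|x\|^2\qquad\text{for all }x\in H.$$ Suppose that $0<\alpha\le\|f_i\|\le\beta$ for all $1\le i\le k$, and let $0<\epsilon<1$. Then there is a subset $\sigma\subset\{1,\dots,k\}$ with $|\sigma|\ge(1-\epsilon)n$ such that $(f_i)_{i\in\sigma}$ is a Riesz basis for its span with Riesz basis constant $M=g(\epsilon,A,B,\alpha,\beta)$, that is, $$\frac1M\Big(\sum_{i\in\sigma}|a_i|^2\Big)^{1/2}\le\Big\|\sum_{i\in\sigma}a_if_i\Big\|\le M\Big(\sum_{i\in\sigma}|a_i|^2\Big)^{1/2}$$ for all scalars $(a_i)_{i\in\sigma}$. In particular $M$ does not depend on $n$, $k$, $H$ or the frame. -/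

import Mathlib

/-- The finite family `f` is a frame for `H` with frame bounds `A`, `B`. -/
def IsFrame (𝕜 : Type*) {H ι : Type*} [RCLike 𝕜] [NormedAddCommGroup H] [InnerProductSpace 𝕜 H]
    [Fintype ι] (f : ι → H) (A B : ℝ) : Prop :=
  0 < A ∧ 0 < B ∧ ∀ x : H,
    A * ‖x‖ ^ 2 ≤ ∑ i, ‖inner 𝕜 x (f i)‖ ^ 2 ∧ ∑ i, ‖inner 𝕜 x (f i)‖ ^ 2 ≤ B * ‖x‖ ^ 2

/-- The finite family `f` is a Riesz basis for its span with Riesz basis constant `M`. -/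
def IsRieszBasisForSpan (𝕜 : Type*) {H ι : Type*} [RCLike 𝕜] [NormedAddCommGroup H]
    [InnerProductSpace 𝕜 H] [Fintype ι] (f : ι → H) (M : ℝ) : Prop :=
  0 < M ∧ ∀ a : ι → 𝕜,
    1 / M * Real.sqrt (∑ i, ‖a i‖ ^ 2) ≤ ‖∑ i, a i • f i‖ ∧
      ‖∑ i, a i • f i‖ ≤ M * Real.sqrt (∑ i, ‖a i‖ ^ 2)

/-! Synthesis is adjoint to the analysis operator, so `‖∑ aᵢ fᵢ‖²` lies between `A‖Pa‖²` and
`B‖a‖²`, where `P` is the orthogonal projection onto the range of analysis. `P` has rank `n`, and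
summing `‖fᵢ‖²` gives `k ≤ ρn` with `ρ = B/α²`. It remains to find `(1-ε)n` coordinates on which `P`
is bounded below in terms of `ε` and `ρ` alone: restricted invertibility,
`exists_restriction_bounded_below`.

For `n ≥ 2/ε` this is a barrier argument in the style of Batson, Spielman and Srivastava. Columns of
`P` are selected one by one, while a barrier `b` below the spectrum of their Gram matrix `P_σ` drops
by `δ` each time. The potential `tr (P_σ - b)⁻¹ - (n - |σ|)/b` is the trace of the resolvent at `b`
of the frame operator of the selected columns on the range of `P`; the second term comes from its
kernel. Averaging over all columns (`barrier_average_le`) yields one that keeps the potential at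
most `-k - 1/δ`. For `n < 2/ε`, `k` is bounded as well, and a crude greedy choice of `n` columns
suffices. -/

open Matrix

/-! ### Schur complements and the trace of an inverse -/

section SchurStep

variable {𝕜 : Type*} [RCLike 𝕜] {m n : Type*} [Fintype m] [Fintype n] [DecidableEq m]
  [DecidableEq n]

open scoped ComplexOrder in
theorem posDef_fromBlocks_of_schur {A : Matrix m m 𝕜} (hA : A.PosDef) (C : Matrix m n 𝕜)
    (D : Matrix n n 𝕜) (hS : (D - Cᴴ * A⁻¹ * C).PosDef) :
    (fromBlocks A C Cᴴ D).PosDef ∧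
      (fromBlocks A C Cᴴ D)⁻¹.trace = A⁻¹.trace +
        ((D - Cᴴ * A⁻¹ * C)⁻¹ * (1 + Cᴴ * A⁻¹ * A⁻¹ * C)).trace := by
  let := hA.isUnit.invertible
  let iS : Invertible (D - Cᴴ * ⅟A * C) := by
    rw [invOf_eq_nonsing_inv]
    exact hS.isUnit.invertible
  let := fromBlocks₁₁Invertible A C Cᴴ D
  refine ⟨?_, ?_⟩
  · have h := (PosDef.fromBlocks₁₁ C D hA).2 hS.posSemidef
    exact h.posDef_iff_isUnit.2 (isUnit_of_invertible _)
  · rw [← invOf_eq_nonsing_inv (fromBlocks A C Cᴴ D), invOf_fromBlocks₁₁_eq]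
    simp only [invOf_eq_nonsing_inv, trace, diag, Fintype.sum_sum_type, fromBlocks_apply₁₁,
      fromBlocks_apply₂₂]
    change trace _ + trace _ = trace _ + trace _
    rw [trace_add, mul_add, mul_one, trace_add, add_assoc, add_comm (trace _) (trace (_ * _))]
    congr 2
    set Z := (D - Cᴴ * A⁻¹ * C)⁻¹
    rw [show A⁻¹ * C * Z * Cᴴ * A⁻¹ = (A⁻¹ * C) * (Z * Cᴴ * A⁻¹) by simp only [Matrix.mul_assoc],
      trace_mul_comm]
    simp only [Matrix.mul_assoc]

end SchurStep

/-! ### Shifted Gram matrices and one-column extensions -/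

/-- The Gram matrix of the columns `σ` of a projection `P`, shifted by the barrier `b`. -/
def shiftedGram {𝕜 ι κ : Type*} [RCLike 𝕜] [DecidableEq κ] (P : Matrix ι ι 𝕜) (σ : κ → ι)
    (b : ℝ) : Matrix κ κ 𝕜 :=
  P.submatrix σ σ - (b : 𝕜) • 1

/-- The matrix whose diagonal holds the Schur complements of the one-column extensions of `σ`. -/
noncomputable def schurGain {𝕜 ι κ : Type*} [RCLike 𝕜] [Fintype κ] [DecidableEq κ] [DecidableEq ι]
    (P : Matrix ι ι 𝕜) (σ : κ → ι) (b : ℝ) : Matrix ι ι 𝕜 :=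
  P - (b : 𝕜) • 1 - (P.submatrix σ id)ᴴ * (shiftedGram P σ b)⁻¹ * P.submatrix σ id

/-- The matrix whose diagonal holds the numerators of the trace increments of the one-column
extensions of `σ`. -/
noncomputable def schurCost {𝕜 ι κ : Type*} [RCLike 𝕜] [Fintype κ] [DecidableEq κ] [DecidableEq ι]
    (P : Matrix ι ι 𝕜) (σ : κ → ι) (b : ℝ) : Matrix ι ι 𝕜 :=
  1 + (P.submatrix σ id)ᴴ * (shiftedGram P σ b)⁻¹ * (shiftedGram P σ b)⁻¹ * P.submatrix σ id

section Extension

open scoped ComplexOrder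

variable {𝕜 ι κ : Type*} [RCLike 𝕜] [Fintype κ] [DecidableEq κ] {P : Matrix ι ι 𝕜} {σ : κ → ι} {b c : ℝ}

theorem isHermitian_schurGain [DecidableEq ι] (hP : P.IsHermitian) (hM : (shiftedGram P σ b).PosDef) :
    (schurGain P σ b).IsHermitian := by
  unfold schurGain
  refine (hP.sub ?_).sub (isHermitian_conjTranspose_mul_mul _ hM.inv.isHermitian)
  simp [IsHermitian, conjTranspose_smul]

theorem one_le_re_schurCost [Finite ι] [DecidableEq ι] (hM : (shiftedGram P σ b).PosDef) (v : ι) :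
    1 ≤ RCLike.re (schurCost P σ b v v) := by
  have h : ((P.submatrix σ id)ᴴ * (shiftedGram P σ b)⁻¹ * (shiftedGram P σ b)⁻¹ *
      P.submatrix σ id).PosSemidef := by
    have := posSemidef_conjTranspose_mul_self ((shiftedGram P σ b)⁻¹ * P.submatrix σ id)
    rw [conjTranspose_mul, hM.inv.isHermitian.eq] at this
    simpa only [Matrix.mul_assoc] using this
  have h2 := (RCLike.nonneg_iff.1 (h.diag_nonneg (i := v))).1
  simp only [schurCost, Matrix.add_apply, one_apply_eq, map_add, RCLike.one_re]
  linarith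

theorem shiftedGram_extend [DecidableEq ι] (hP : P.IsHermitian) (hM : (shiftedGram P σ b).PosDef) (v : ι)
    (hv : 0 < RCLike.re (schurGain P σ b v v)) :
    (shiftedGram P (Sum.elim σ (fun _ : Unit => v)) b).PosDef ∧
      RCLike.re (shiftedGram P (Sum.elim σ (fun _ : Unit => v)) b)⁻¹.trace =
        RCLike.re (shiftedGram P σ b)⁻¹.trace +
          RCLike.re (schurCost P σ b v v) / RCLike.re (schurGain P σ b v v) := by
  set C : Matrix κ Unit 𝕜 := P.submatrix σ (fun _ => v) with hC
  set D : Matrix Unit Unit 𝕜 := P.submatrix (fun _ => v) (fun _ => v) - (b : 𝕜) • 1 with hD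
  have hblock : shiftedGram P (Sum.elim σ (fun _ : Unit => v)) b =
      fromBlocks (shiftedGram P σ b) C Cᴴ D := by
    ext i j
    rcases i with i | i <;> rcases j with j | j <;>
      simp [shiftedGram, hC, hD, one_apply, hP.apply]
  have hgain : D - Cᴴ * (shiftedGram P σ b)⁻¹ * C =
      diagonal (fun _ => schurGain P σ b v v) := by
    ext i j
    simp [schurGain, hC, hD, Matrix.mul_apply]
  have hcost : 1 + Cᴴ * (shiftedGram P σ b)⁻¹ * (shiftedGram P σ b)⁻¹ * C =
      diagonal (fun _ => schurCost P σ b v v) := by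
    ext i j
    simp [schurCost, hC, Matrix.mul_apply]
  obtain ⟨s, hs⟩ : ∃ s : ℝ, schurGain P σ b v v = s :=
    ⟨_, (RCLike.conj_eq_iff_re.1 ((isHermitian_schurGain hP hM).apply v v)).symm⟩
  have hs0 : 0 < s := by simpa [hs] using hv
  have hSpos : (D - Cᴴ * (shiftedGram P σ b)⁻¹ * C).PosDef := by
    rw [hgain, hs]
    exact PosDef.diagonal fun _ => by exact_mod_cast hs0
  obtain ⟨h1, h2⟩ := posDef_fromBlocks_of_schur hM C D hSpos
  rw [hblock]
  refine ⟨h1, ?_⟩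
  rw [h2, hgain, hcost, hs]
  have hinv : (diagonal (fun _ : Unit => (s : 𝕜)))⁻¹ = diagonal (fun _ => ((s⁻¹ : ℝ) : 𝕜)) := by
    apply inv_eq_left_inv
    rw [diagonal_mul_diagonal, ← diagonal_one]
    congr 1
    ext
    rw [← RCLike.ofReal_mul, inv_mul_cancel₀ hs0.ne']
    simp
  rw [hinv, diagonal_mul_diagonal, map_add]
  simp only [trace_diagonal, Finset.univ_unique, Finset.sum_singleton, RCLike.re_ofReal_mul,
    RCLike.ofReal_re]
  rw [div_eq_inv_mul]

theorem submatrix_mul_conjTranspose_of_idempotent {ι κ : Type*} [Fintype ι] {P : Matrix ι ι 𝕜}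
    (hP : P.IsHermitian) (hPP : P * P = P)
    (σ : κ → ι) : P.submatrix σ id * (P.submatrix σ id)ᴴ = P.submatrix σ σ := by
  rw [conjTranspose_submatrix, hP.eq, ← submatrix_mul P P σ id σ Function.bijective_id, hPP]

theorem submatrix_eq_shiftedGram_add {κ : Type*} [DecidableEq κ] (P : Matrix ι ι 𝕜) (σ : κ → ι) (b : ℝ) :
    P.submatrix σ σ = shiftedGram P σ b + (b : 𝕜) • 1 := by
  simp [shiftedGram]

/-- Idempotence turns `C Cᴴ` into `P_σ = (P_σ - b) + b`, so the sum over all columns collapses to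
traces of powers of the resolvent. The same holds for the cost. -/
theorem re_trace_schurGain [Fintype ι] [DecidableEq ι] (hP : P.IsHermitian) (hPP : P * P = P)
    (hM : (shiftedGram P σ b).PosDef) :
    RCLike.re (schurGain P σ b).trace = RCLike.re P.trace - b * Fintype.card ι -
      (Fintype.card κ + b * RCLike.re (shiftedGram P σ b)⁻¹.trace) := by
  have hu := (isUnit_iff_isUnit_det _).1 hM.isUnit
  rw [schurGain, trace_sub, trace_sub, Matrix.mul_assoc, trace_mul_comm, Matrix.mul_assoc,
    submatrix_mul_conjTranspose_of_idempotent hP hPP, submatrix_eq_shiftedGram_add P σ b,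
    mul_add, nonsing_inv_mul _ hu]
  simp [trace_smul, RCLike.smul_re]

theorem re_trace_schurCost [Fintype ι] [DecidableEq ι] (hP : P.IsHermitian) (hPP : P * P = P)
    (hM : (shiftedGram P σ b).PosDef) :
    RCLike.re (schurCost P σ b).trace = Fintype.card ι +
      (RCLike.re (shiftedGram P σ b)⁻¹.trace +
        b * RCLike.re ((shiftedGram P σ b)⁻¹ * (shiftedGram P σ b)⁻¹).trace) := by
  have hu := (isUnit_iff_isUnit_det _).1 hM.isUnit
  rw [schurCost, trace_add, Matrix.mul_assoc, Matrix.mul_assoc, trace_mul_comm, Matrix.mul_assoc,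
    Matrix.mul_assoc,
    submatrix_mul_conjTranspose_of_idempotent hP hPP, submatrix_eq_shiftedGram_add P σ b,
    mul_add, nonsing_inv_mul _ hu]
  simp [trace_smul, mul_add, RCLike.smul_re]

theorem shiftedGram_eq_add {κ : Type*} [DecidableEq κ] (P : Matrix ι ι 𝕜) (σ : κ → ι) (b c : ℝ) :
    shiftedGram P σ c = shiftedGram P σ b + ((b - c : ℝ) : 𝕜) • 1 := by
  simp only [shiftedGram, RCLike.ofReal_sub, sub_smul]
  abel

theorem shiftedGram_posDef_mono {κ : Type*} [DecidableEq κ] {σ : κ → ι}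
    (hM : (shiftedGram P σ b).PosDef) (hcb : c ≤ b) :
    (shiftedGram P σ c).PosDef := by
  rw [shiftedGram_eq_add P σ b c]
  refine hM.add_posSemidef (PosSemidef.one.smul ?_)
  exact_mod_cast sub_nonneg.2 hcb

/-- Resolvent comparison of the traces of the inverses at two barriers. -/
theorem re_trace_inv_mul_inv_le (hM : (shiftedGram P σ b).PosDef) (hcb : c ≤ b) :
    (b - c) * RCLike.re ((shiftedGram P σ c)⁻¹ * (shiftedGram P σ c)⁻¹).trace ≤
      RCLike.re (shiftedGram P σ b)⁻¹.trace - RCLike.re (shiftedGram P σ c)⁻¹.trace := by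
  have hM' := shiftedGram_posDef_mono hM hcb
  have hu := (isUnit_iff_isUnit_det _).1 hM.isUnit
  have hu' := (isUnit_iff_isUnit_det _).1 hM'.isUnit
  have hadd := shiftedGram_eq_add P σ b c
  set M := shiftedGram P σ b
  set M' := shiftedGram P σ c
  set d : ℝ := b - c
  have h1 : M⁻¹ = M'⁻¹ + (d : 𝕜) • (M⁻¹ * M'⁻¹) := by
    calc M⁻¹ = M⁻¹ * (M' * M'⁻¹) := by rw [mul_nonsing_inv _ hu', mul_one]
      _ = M⁻¹ * ((M + (d : 𝕜) • 1) * M'⁻¹) := by rw [← hadd]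
      _ = _ := by
        rw [add_mul, mul_add, ← Matrix.mul_assoc, nonsing_inv_mul _ hu]
        simp
  have h2 : M⁻¹ = M'⁻¹ + (d : 𝕜) • (M'⁻¹ * M⁻¹) := by
    calc M⁻¹ = (M'⁻¹ * M') * M⁻¹ := by rw [nonsing_inv_mul _ hu', one_mul]
      _ = (M'⁻¹ * (M + (d : 𝕜) • 1)) * M⁻¹ := by rw [← hadd]
      _ = _ := by
        rw [mul_add, add_mul, Matrix.mul_assoc, mul_nonsing_inv _ hu]
        simp
  -- The resolvent identity applied twice, so that the remainder is visibly positive semidefinite.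
  have h3 : M⁻¹ = M'⁻¹ + (d : 𝕜) • (M'⁻¹ * M'⁻¹) + ((d * d : ℝ) : 𝕜) • (M'⁻¹ * M⁻¹ * M'⁻¹) := by
    conv_lhs => rw [h1, h2]
    rw [add_mul, smul_add, smul_mul_assoc, smul_smul, add_assoc, RCLike.ofReal_mul]
  have hpos : (M'⁻¹ * M⁻¹ * M'⁻¹).PosSemidef := by
    have := hM.inv.posSemidef.conjTranspose_mul_mul_same M'⁻¹
    rwa [hM'.inv.isHermitian.eq] at this
  have h4 := (RCLike.nonneg_iff.1 hpos.trace_nonneg).1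
  have h5 := congrArg (fun X : Matrix κ κ 𝕜 => RCLike.re X.trace) h3
  simp only [trace_add, trace_smul, smul_eq_mul, map_add, RCLike.re_ofReal_mul] at h5
  nlinarith [mul_nonneg (mul_self_nonneg d) h4]

theorem re_trace_inv_nonneg (hM : (shiftedGram P σ b).PosDef) :
    0 ≤ RCLike.re (shiftedGram P σ b)⁻¹.trace :=
  (RCLike.nonneg_iff.1 hM.inv.posSemidef.trace_nonneg).1

theorem re_trace_inv_mul_inv_nonneg (hM : (shiftedGram P σ b).PosDef) :
    0 ≤ RCLike.re ((shiftedGram P σ b)⁻¹ * (shiftedGram P σ b)⁻¹).trace := by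
  have h := posSemidef_conjTranspose_mul_self (shiftedGram P σ b)⁻¹
  rw [hM.inv.isHermitian.eq] at h
  exact (RCLike.nonneg_iff.1 h.trace_nonneg).1

-- Every eigenvalue of the matrix shifted by `c` is at least `b - c`, so each term of the trace is
-- at most 1.
open scoped MatrixOrder Matrix.Norms.L2Operator in
theorem mul_re_trace_inv_le_card (hM : (shiftedGram P σ b).PosDef) (hcb : c ≤ b) :
    (b - c) * RCLike.re (shiftedGram P σ c)⁻¹.trace ≤ Fintype.card κ := by
  have hM' := shiftedGram_posDef_mono hM hcb
  have hu' := (isUnit_iff_isUnit_det _).1 hM'.isUnit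
  have hadd := shiftedGram_eq_add P σ b c
  obtain ⟨R, hR⟩ := CStarAlgebra.nonneg_iff_eq_star_mul_self.1 hM'.inv.posSemidef.nonneg
  have h1 : (R * shiftedGram P σ b * Rᴴ).PosSemidef :=
    hM.posSemidef.mul_mul_conjTranspose_same R
  have h2 := (RCLike.nonneg_iff.1 h1.trace_nonneg).1
  rw [trace_mul_comm, ← Matrix.mul_assoc, ← star_eq_conjTranspose, ← hR] at h2
  have h3 : (shiftedGram P σ c)⁻¹ * shiftedGram P σ b +
      ((b - c : ℝ) : 𝕜) • (shiftedGram P σ c)⁻¹ = 1 := by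
    calc _ = (shiftedGram P σ c)⁻¹ * (shiftedGram P σ b + ((b - c : ℝ) : 𝕜) • 1) := by
          rw [mul_add, mul_smul_comm, mul_one]
      _ = 1 := by rw [← hadd, nonsing_inv_mul _ hu']
  have h4 := congrArg (fun X : Matrix κ κ 𝕜 => RCLike.re X.trace) h3
  simp only [trace_add, trace_smul, smul_eq_mul, map_add, RCLike.re_ofReal_mul, trace_one,
    RCLike.natCast_re] at h4
  linarith

end Extension

/-! ### The barrier argument and the greedy argument -/

section Barrier

open scoped ComplexOrder

/-- The inequality behind the averaging: total cost is at most the allowed rise of the trace times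
total gain. Here `m` is the kernel dimension, `T` the trace at `b`, and `τ₁`, `τ₂` the traces of the
inverse and its square at `b - δ`. -/
theorem barrier_average_le {k m b δ T τ₁ τ₂ : ℝ} (hδ : 0 < δ) (hδb : δ < b)
    (hΦ : T - m / b ≤ -k - 1 / δ) (hm : b ≤ δ * m) (hτ₂ : 0 ≤ τ₂) (hT : δ * τ₂ ≤ T - τ₁) :
    0 < m - (b - δ) * k - (b - δ) * τ₁ ∧
      k + (τ₁ + (b - δ) * τ₂) ≤
        (T - τ₁ + (m - 1) / (b - δ) - m / b) * (m - (b - δ) * k - (b - δ) * τ₁) := by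
  obtain ⟨c, rfl⟩ : ∃ c, b = c + δ := ⟨b - δ, by ring⟩
  have hc : 0 < c := by linarith
  rw [add_sub_cancel_right]
  have hb : 0 < c + δ := by linarith
  have hm0 : 0 < m := by
    by_contra h
    nlinarith
  -- `E` is the increase `m / c - m / b` of the contribution of the kernel.
  obtain ⟨E, hE⟩ : ∃ E, E = m / c - m / (c + δ) := ⟨_, rfl⟩
  have hE' : E = m * δ / (c * (c + δ)) := by
    rw [hE]; field_simp; ring
  have hE0 : 0 < E := by rw [hE']; positivity
  have hkey : m / c ^ 2 ≤ E * (1 / δ + E) := by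
    have : E * (1 / δ + E) - m / c ^ 2 =
        m * δ * (δ * m - (c + δ)) / (c ^ 2 * (c + δ) ^ 2) := by
      rw [hE']; field_simp; ring
    have h2 : 0 ≤ m * δ * (δ * m - (c + δ)) / (c ^ 2 * (c + δ) ^ 2) := by
      have : 0 ≤ δ * m - (c + δ) := by linarith
      positivity
    linarith
  obtain ⟨F, hF⟩ : ∃ F, F = T - τ₁ := ⟨_, rfl⟩
  have hF0 : 0 ≤ F := by rw [hF]; nlinarith
  -- `X` is `-k` minus the potential at the lowered barrier; lowering the barrier has decreased the
  -- potential by `E + F`.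
  obtain ⟨X, hX⟩ : ∃ X, X = -k - (τ₁ - m / c) := ⟨_, rfl⟩
  have hX1 : 1 / δ + E + F ≤ X := by rw [hX, hE, hF]; linarith
  have hδi : 0 < 1 / δ := by positivity
  have hS : m - c * k - c * τ₁ = c * X := by
    rw [hX]; field_simp; ring
  have hD : T - τ₁ + (m - 1) / c - m / (c + δ) = F + E - 1 / c := by
    rw [hF, hE]; ring
  rw [hS, hD]
  refine ⟨mul_pos hc (by linarith), ?_⟩
  have hprod : τ₂ + m / c ^ 2 ≤ (F + E) * X := by
    have h1 : τ₂ ≤ F * (1 / δ) := by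
      rw [mul_one_div, le_div_iff₀ hδ]; linarith
    have h2 : (F + E) * (1 / δ + E + F) ≤ (F + E) * X :=
      mul_le_mul_of_nonneg_left hX1 (by linarith)
    nlinarith [mul_nonneg hF0 hE0.le, mul_nonneg hF0 hF0]
  have h3 := mul_le_mul_of_nonneg_left hprod hc.le
  have h4 : (F + E - 1 / c) * (c * X) = c * ((F + E) * X) - X := by
    field_simp
  have h5 : c * (τ₂ + m / c ^ 2) = c * τ₂ + m / c := by
    field_simp
  rw [h4]
  rw [h5] at h3
  have : X = -k - τ₁ + m / c := by rw [hX]; ring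
  linarith

variable {𝕜 ι : Type*} [RCLike 𝕜] [Fintype ι] [DecidableEq ι] {P : Matrix ι ι 𝕜}

theorem exists_extend_barrier {κ : Type*} [Fintype κ] [DecidableEq κ] {σ : κ → ι} {b δ n : ℝ}
    (hP : P.IsHermitian) (hPP : P * P = P) (hn : RCLike.re P.trace = n)
    (hM : (shiftedGram P σ b).PosDef) (hδ : 0 < δ) (hδb : δ < b)
    (hΦ : RCLike.re (shiftedGram P σ b)⁻¹.trace - (n - Fintype.card κ) / b ≤
      -Fintype.card ι - 1 / δ)
    (hm : b ≤ δ * (n - Fintype.card κ)) :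
    ∃ v : ι, (shiftedGram P (Sum.elim σ (fun _ : Unit => v)) (b - δ)).PosDef ∧
      RCLike.re (shiftedGram P (Sum.elim σ (fun _ : Unit => v)) (b - δ))⁻¹.trace -
        (n - Fintype.card κ - 1) / (b - δ) ≤ -Fintype.card ι - 1 / δ := by
  have hle : b - δ ≤ b := by linarith
  have hM' := shiftedGram_posDef_mono hM hle
  have hT := re_trace_inv_mul_inv_le hM hle
  rw [sub_sub_cancel] at hT
  obtain ⟨hS, hN⟩ := barrier_average_le hδ hδb hΦ hm (re_trace_inv_mul_inv_nonneg hM') hT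
  have hgain := re_trace_schurGain hP hPP hM'
  have hcost := re_trace_schurCost hP hPP hM'
  rw [hn] at hgain
  set T := RCLike.re (shiftedGram P σ b)⁻¹.trace
  set τ := RCLike.re (shiftedGram P σ (b - δ))⁻¹.trace
  set D := T - τ + (n - Fintype.card κ - 1) / (b - δ) - (n - Fintype.card κ) / b with hD
  have hgain' : RCLike.re (schurGain P σ (b - δ)).trace =
      n - Fintype.card κ - (b - δ) * Fintype.card ι - (b - δ) * τ := by
    rw [hgain]; ring
  rw [← hgain', ← hcost] at hN
  rw [← hgain'] at hS
  simp only [trace, diag, map_sum] at hN hS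
  obtain ⟨v₀, -, -⟩ := Finset.exists_ne_zero_of_sum_ne_zero hS.ne'
  have hD0 : 0 < D := by
    by_contra h
    have h1 : (1 : ℝ) ≤ ∑ i, RCLike.re (schurCost P σ (b - δ) i i) :=
      (one_le_re_schurCost hM' v₀).trans
        (Finset.single_le_sum (f := fun i => RCLike.re (schurCost P σ (b - δ) i i))
          (fun i _ => zero_le_one.trans (one_le_re_schurCost hM' i)) (Finset.mem_univ v₀))
    nlinarith
  rw [Finset.mul_sum] at hN
  obtain ⟨v, -, hv⟩ := Finset.exists_le_of_sum_le ⟨v₀, Finset.mem_univ v₀⟩ hN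
  -- A cost of at least 1 bounded by `D * gain` with `D > 0` forces a positive gain, so the
  -- extension stays positive definite.
  have hc1 := one_le_re_schurCost hM' v
  have hv0 : 0 < RCLike.re (schurGain P σ (b - δ) v v) := by
    by_contra h
    nlinarith
  obtain ⟨h1, h2⟩ := shiftedGram_extend hP hM' v hv0
  refine ⟨v, h1, ?_⟩
  rw [h2]
  have h3 := (div_le_iff₀ hv0).2 hv
  linarith

theorem posDef_of_isEmpty {κ : Type*} [IsEmpty κ] (M : Matrix κ κ 𝕜) : M.PosDef := by
  let := Fintype.ofIsEmpty (α := κ)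
  refine PosDef.of_dotProduct_mulVec_pos (Subsingleton.elim _ _) fun x hx => ?_
  exact absurd (Subsingleton.elim _ _) hx

/-- The condition `b ≤ δ * n` persists, since each step lowers the barrier and `δ * (n - r)` by the
same `δ`. -/
theorem exists_shiftedGram_posDef_barrier {b δ n : ℝ} (hP : P.IsHermitian) (hPP : P * P = P)
    (hn : RCLike.re P.trace = n) (hδ : 0 < δ) (hb : b ≤ δ * n)
    (hΦ : -(n / b) ≤ -Fintype.card ι - 1 / δ) (r : ℕ) (hr : r * δ < b) :
    ∃ (κ : Type) (_ : Fintype κ) (_ : DecidableEq κ) (σ : κ → ι), Fintype.card κ = r ∧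
      (shiftedGram P σ (b - r * δ)).PosDef ∧
      RCLike.re (shiftedGram P σ (b - r * δ))⁻¹.trace - (n - r) / (b - r * δ) ≤
        -Fintype.card ι - 1 / δ := by
  induction r with
  | zero =>
    refine ⟨Empty, inferInstance, inferInstance, Empty.elim, rfl, posDef_of_isEmpty _, ?_⟩
    simpa [trace] using hΦ
  | succ r ih =>
    push_cast at hr ⊢
    obtain ⟨κ, _, _, σ, hcard, hM, hpot⟩ := ih (by linarith)
    subst hcard
    obtain ⟨v, h1, h2⟩ := exists_extend_barrier hP hPP hn hM hδ (by linarith) hpot (by linarith)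
    have he : b - (Fintype.card κ + 1) * δ = b - Fintype.card κ * δ - δ := by ring
    refine ⟨κ ⊕ Unit, inferInstance, inferInstance, Sum.elim σ (fun _ => v), by simp, ?_, ?_⟩
    · rw [he]; exact h1
    · rw [he, ← sub_sub]; exact h2

/-- Shrinking the barrier by `4k` at each step makes the loss in the total gain less than 1, so some
column has positive gain while `r < n`. -/
theorem exists_shiftedGram_posDef_greedy {n : ℕ} (hP : P.IsHermitian) (hPP : P * P = P)
    (hn : RCLike.re P.trace = n) (hnk : n ≤ Fintype.card ι) (r : ℕ) (hr : r ≤ n) :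
    ∃ (κ : Type) (_ : Fintype κ) (_ : DecidableEq κ) (σ : κ → ι), Fintype.card κ = r ∧
      (shiftedGram P σ ((1 / (4 * Fintype.card ι)) ^ r)).PosDef := by
  induction r with
  | zero => exact ⟨Empty, inferInstance, inferInstance, Empty.elim, rfl, posDef_of_isEmpty _⟩
  | succ r ih =>
    obtain ⟨κ, _, _, σ, hcard, hM⟩ := ih (by omega)
    have hk : (1 : ℝ) ≤ Fintype.card ι := by exact_mod_cast (by omega : 1 ≤ Fintype.card ι)
    have hrk : (r : ℝ) ≤ Fintype.card ι := by exact_mod_cast (by omega : r ≤ Fintype.card ι)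
    have hrn : (r : ℝ) + 1 ≤ n := by exact_mod_cast hr
    set k : ℝ := (Fintype.card ι : ℝ)
    set b : ℝ := (1 / (4 * k)) ^ r with hb
    set c : ℝ := (1 / (4 * k)) ^ (r + 1) with hc
    have hq : 0 < 1 / (4 * k) := by positivity
    have hb0 : 0 < b := pow_pos hq r
    have hb1 : b ≤ 1 := pow_le_one₀ hq.le (by rw [div_le_one (by positivity)]; linarith)
    have hcb : 4 * (c * k) = b := by
      rw [hc, pow_succ, ← hb]; field_simp
    have hc0 : 0 < c := pow_pos hq _
    have hcb' : 4 * c ≤ b := by nlinarith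
    have hle : c ≤ b := by linarith
    have hM' := shiftedGram_posDef_mono hM hle
    have hT := mul_re_trace_inv_le_card hM hle
    have hT0 := re_trace_inv_nonneg hM'
    have hgain := re_trace_schurGain hP hPP hM'
    rw [hn, hcard] at hgain
    rw [hcard] at hT
    set T := RCLike.re (shiftedGram P σ c)⁻¹.trace
    have hcT : c * T ≤ 1 / 3 := by
      have h1 : 3 * (c * T) ≤ (b - c) * T := by nlinarith
      have h2 : k * (3 * (c * T)) ≤ k * 1 := by
        have : 3 * k * c * T ≤ (b - c) * T := by nlinarith
        nlinarith
      have := le_of_mul_le_mul_left h2 (by linarith)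
      linarith
    have hpos : 0 < RCLike.re (schurGain P σ c).trace := by
      rw [hgain]; nlinarith
    simp only [trace, diag, map_sum] at hpos
    obtain ⟨v, -, hv⟩ := Finset.exists_lt_of_sum_lt
      (s := Finset.univ) (f := fun _ : ι => (0 : ℝ)) (by simpa using hpos)
    exact ⟨κ ⊕ Unit, inferInstance, inferInstance, Sum.elim σ (fun _ => v), by simp [hcard],
      (shiftedGram_extend hP hM' v hv).1⟩

theorem exists_finset_of_shiftedGram_posDef {κ : Type*} [Fintype κ] [DecidableEq κ] {σ : κ → ι}
    {b : ℝ} (hb : 0 ≤ b) (hM : (shiftedGram P σ b).PosDef) :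
    ∃ τ : Finset ι, τ.card = Fintype.card κ ∧ ∀ a : ι → 𝕜, (∀ i ∉ τ, a i = 0) →
      b * ∑ i, ‖a i‖ ^ 2 ≤ RCLike.re (star a ⬝ᵥ P *ᵥ a) := by
  have hform : ∀ x : κ → 𝕜, star x ⬝ᵥ (shiftedGram P σ b) *ᵥ x =
      star x ⬝ᵥ (P.submatrix σ σ) *ᵥ x - ((b * ∑ i, ‖x i‖ ^ 2 : ℝ) : 𝕜) := by
    intro x
    rw [shiftedGram, sub_mulVec, dotProduct_sub, smul_mulVec, one_mulVec, dotProduct_smul]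
    congr 1
    simp [dotProduct, RCLike.conj_mul]
  -- A repeated column would put `eᵢ - eⱼ` in the kernel of `P_σ`, impossible for `b ≥ 0`.
  have hinj : Function.Injective σ := by
    intro i j hij
    by_contra hne
    have hx : (Pi.single i 1 - Pi.single j 1 : κ → 𝕜) ≠ 0 := by
      intro h
      have := congrFun h i
      simp [hne] at this
    have h1 := hM.dotProduct_mulVec_pos hx
    have h0 : (P.submatrix σ σ) *ᵥ (Pi.single i 1 - Pi.single j 1 : κ → 𝕜) = 0 := by
      ext l
      simp [mulVec_sub, hij]
    rw [hform, h0, dotProduct_zero, zero_sub] at h1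
    have h2 : 0 < -(b * ∑ l, ‖(Pi.single i 1 - Pi.single j 1 : κ → 𝕜) l‖ ^ 2) := by
      have h3 := (RCLike.pos_iff.1 h1).1
      rw [← RCLike.ofReal_neg, RCLike.ofReal_re] at h3
      exact h3
    have h4 : 0 ≤ b * ∑ l, ‖(Pi.single i 1 - Pi.single j 1 : κ → 𝕜) l‖ ^ 2 := by positivity
    linarith
  refine ⟨Finset.univ.image σ, by rw [Finset.card_image_of_injective _ hinj, Finset.card_univ],
    fun a ha => ?_⟩
  have ha' : ∀ i ∉ Set.range σ, a i = 0 := fun i hi => ha i (by simpa using hi)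
  have hnorm : ∑ x, ‖a (σ x)‖ ^ 2 = ∑ i, ‖a i‖ ^ 2 :=
    Fintype.sum_of_injective σ hinj _ _ (fun i hi => by simp [ha' i hi]) fun _ => rfl
  have hquad : star (a ∘ σ) ⬝ᵥ (P.submatrix σ σ) *ᵥ (a ∘ σ) = star a ⬝ᵥ P *ᵥ a := by
    refine Fintype.sum_of_injective σ hinj _ _ (fun i hi => by simp [ha' i hi]) fun x => ?_
    simp only [Pi.star_apply, Function.comp_apply]
    congr 1
    exact Fintype.sum_of_injective σ hinj _ _ (fun i hi => by simp [ha' i hi]) fun _ => rfl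
  have h1 := (RCLike.nonneg_iff.1 (hM.posSemidef.dotProduct_mulVec_nonneg (a ∘ σ))).1
  rw [hform, hquad, map_sub, RCLike.ofReal_re] at h1
  simp only [Function.comp_apply] at h1
  rw [hnorm] at h1
  linarith

/-! ### Restricted invertibility -/

/-- The lower bound for the restriction of a projection of rank `n` and size at most `ρ * n` to
`(1 - ε) * n` coordinates. -/
noncomputable def restrictionBound (ε ρ : ℝ) : ℝ :=
  min ((ε / 4) ^ 2 / ρ) ((1 / (4 * (⌈2 * ρ / ε⌉₊ + 1))) ^ ⌈2 / ε⌉₊)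

theorem restrictionBound_pos {ε ρ : ℝ} (hε : 0 < ε) (hρ : 0 < ρ) : 0 < restrictionBound ε ρ :=
  lt_min (by positivity) (by positivity)

/-- Restricted invertibility for orthogonal projections. -/
theorem exists_restriction_bounded_below {n : ℕ} {ε ρ : ℝ} (hP : P.IsHermitian)
    (hPP : P * P = P) (hn : RCLike.re P.trace = n) (hnk : n ≤ Fintype.card ι)
    (hρ : (Fintype.card ι : ℝ) ≤ ρ * n) (hρ0 : 0 < ρ) (hε : 0 < ε) (hε1 : ε < 1) :
    ∃ τ : Finset ι, (1 - ε) * (n : ℝ) ≤ τ.card ∧ ∀ a : ι → 𝕜, (∀ i ∉ τ, a i = 0) →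
      restrictionBound ε ρ * ∑ i, ‖a i‖ ^ 2 ≤ RCLike.re (star a ⬝ᵥ P *ᵥ a) := by
  suffices h : ∃ (κ : Type) (_ : Fintype κ) (_ : DecidableEq κ) (σ : κ → ι),
      (1 - ε) * (n : ℝ) ≤ Fintype.card κ ∧
        (shiftedGram P σ (restrictionBound ε ρ)).PosDef by
    obtain ⟨κ, _, _, σ, hcard, hM⟩ := h
    obtain ⟨τ, hτ, h⟩ :=
      exists_finset_of_shiftedGram_posDef (restrictionBound_pos hε hρ0).le hM
    exact ⟨τ, by rw [hτ]; exact hcard, h⟩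
  rcases Nat.eq_zero_or_pos n with rfl | hn0
  · exact ⟨Empty, inferInstance, inferInstance, Empty.elim, by simp, posDef_of_isEmpty _⟩
  have hk : (0 : ℝ) < Fintype.card ι := by exact_mod_cast hn0.trans_le hnk
  have hn0' : (0 : ℝ) < n := by exact_mod_cast hn0
  rcases le_or_gt (2 / ε) n with hlarge | hsmall
  · rw [div_le_iff₀ hε] at hlarge
    set k : ℝ := (Fintype.card ι : ℝ)
    set t : ℝ := 1 - ε / 4 with ht
    have ht0 : 0 < t := by linarith
    have ht1 : 0 < 1 - t := by linarith
    set r := ⌈(1 - ε) * (n : ℝ)⌉₊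
    -- Rounding up costs at most 1, which `2 ≤ ε * n` absorbs.
    have hr : (r : ℝ) ≤ t ^ 2 * n := by
      have h1 : (r : ℝ) < (1 - ε) * n + 1 := Nat.ceil_lt_add_one (by nlinarith)
      have h2 : (1 - ε / 2) * n ≤ t ^ 2 * n :=
        mul_le_mul_of_nonneg_right (by rw [ht]; nlinarith) hn0'.le
      linarith
    have hbr : (1 - t) * n / k - r * ((1 - t) / (t * k)) = (1 - t) / (t * k) * (t * n - r) := by
      field_simp
    have hcoef : 0 < (1 - t) / (t * k) := by positivity
    have hbound : (1 - t) ^ 2 * n / k ≤ (1 - t) * n / k - r * ((1 - t) / (t * k)) := by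
      rw [hbr]
      calc (1 - t) ^ 2 * n / k = (1 - t) / (t * k) * (t * n - t ^ 2 * n) := by field_simp
        _ ≤ _ := mul_le_mul_of_nonneg_left (by linarith) hcoef.le
    have hpos : 0 < (1 - t) ^ 2 * n / k := by positivity
    -- With these values the empty selection meets the potential bound with equality: `n / b = k /
    -- (1 - t) = k + 1 / δ`.
    obtain ⟨κ, i1, i2, σ, hcard, hM, -⟩ := exists_shiftedGram_posDef_barrier
      (b := (1 - t) * n / k) (δ := (1 - t) / (t * k)) hP hPP hn hcoef
      (by
        have : (1 - t) / (t * k) * n - (1 - t) * n / k = (1 - t) ^ 2 * n / (t * k) := by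
          field_simp
        have h2 : 0 ≤ (1 - t) ^ 2 * n / (t * k) := by positivity
        linarith)
      (by
        apply le_of_eq
        change _ = -k - _
        field_simp
        ring)
      r (by linarith)
    refine ⟨κ, i1, i2, σ, by rw [hcard]; exact Nat.le_ceil _, shiftedGram_posDef_mono hM ?_⟩
    refine (min_le_left _ _).trans (le_trans ?_ hbound)
    have : (1 - t) = ε / 4 := by rw [ht]; ring
    rw [this, mul_div_assoc, div_eq_mul_inv]
    refine mul_le_mul_of_nonneg_left ?_ (by positivity)
    rw [inv_le_comm₀ hρ0 (by positivity), inv_div, div_le_iff₀ hn0']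
    exact hρ
  · obtain ⟨κ, i1, i2, σ, hcard, hM⟩ := exists_shiftedGram_posDef_greedy hP hPP hn hnk n le_rfl
    refine ⟨κ, i1, i2, σ, by rw [hcard]; nlinarith, shiftedGram_posDef_mono hM ?_⟩
    refine (min_le_right _ _).trans ?_
    have hkK : (Fintype.card ι : ℝ) ≤ ⌈2 * ρ / ε⌉₊ + 1 := by
      have h1 : ρ * n ≤ 2 * ρ / ε := by
        rw [mul_comm 2 ρ, mul_div_assoc]
        exact mul_le_mul_of_nonneg_left hsmall.le hρ0.le
      linarith [Nat.le_ceil (2 * ρ / ε)]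
    have hnN : n ≤ ⌈2 / ε⌉₊ := by
      exact_mod_cast hsmall.le.trans (Nat.le_ceil _)
    calc (1 / (4 * ((⌈2 * ρ / ε⌉₊ : ℝ) + 1))) ^ ⌈2 / ε⌉₊
        ≤ (1 / (4 * ((⌈2 * ρ / ε⌉₊ : ℝ) + 1))) ^ n := by
          refine pow_le_pow_of_le_one (by positivity) ?_ hnN
          rw [div_le_one (by positivity)]
          have : (0 : ℝ) ≤ ⌈2 * ρ / ε⌉₊ := by positivity
          linarith
      _ ≤ (1 / (4 * (Fintype.card ι : ℝ))) ^ n := by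
          gcongr

end Barrier

/-! ### Frames and the projection onto the range of analysis -/

section Frame

variable {𝕜 H : Type*} [RCLike 𝕜] [NormedAddCommGroup H] [InnerProductSpace 𝕜 H]
  {ι : Type*} [Fintype ι]

/-- The analysis operator of a finite family. -/
noncomputable def analysisOperator (𝕜 : Type*) {H ι : Type*} [RCLike 𝕜] [NormedAddCommGroup H]
    [InnerProductSpace 𝕜 H] (f : ι → H) : H →ₗ[𝕜] EuclideanSpace 𝕜 ι where
  toFun x := WithLp.toLp 2 fun i => inner 𝕜 (f i) x
  map_add' x y := by ext i; simp [inner_add_right]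
  map_smul' c x := by ext i; simp [inner_smul_right]

theorem norm_sq_analysisOperator (f : ι → H) (x : H) :
    ‖analysisOperator 𝕜 f x‖ ^ 2 = ∑ i, ‖inner 𝕜 x (f i)‖ ^ 2 := by
  rw [EuclideanSpace.norm_sq_eq]
  exact Finset.sum_congr rfl fun i _ => by simp [analysisOperator, norm_inner_symm]

theorem inner_analysisOperator_left (f : ι → H) (x : H) (a : ι → 𝕜) :
    inner 𝕜 (analysisOperator 𝕜 f x) (WithLp.toLp 2 a) = inner 𝕜 x (∑ i, a i • f i) := by
  simp [analysisOperator, PiLp.inner_apply, inner_sum, inner_smul_right]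

theorem IsFrame.injective_analysisOperator {f : ι → H} {A B : ℝ} (hf : IsFrame 𝕜 f A B) :
    Function.Injective (analysisOperator 𝕜 f) := by
  refine (injective_iff_map_eq_zero _).2 fun x hx => ?_
  have h := (hf.2.2 x).1
  rw [← norm_sq_analysisOperator, hx, norm_zero] at h
  have hA := hf.1
  have : ‖x‖ ^ 2 ≤ 0 := by
    by_contra h0
    nlinarith
  simpa using this

theorem IsFrame.norm_sum_smul_le {f : ι → H} {A B : ℝ} (hf : IsFrame 𝕜 f A B) (a : ι → 𝕜) :
    ‖∑ i, a i • f i‖ ≤ Real.sqrt B * Real.sqrt (∑ i, ‖a i‖ ^ 2) := by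
  set s := ∑ i, a i • f i with hs
  have h1 : ‖s‖ ^ 2 ≤ ‖analysisOperator 𝕜 f s‖ * ‖WithLp.toLp 2 a‖ := by
    have := inner_analysisOperator_left f s a
    rw [← hs, inner_self_eq_norm_sq_to_K] at this
    have h := norm_inner_le_norm (𝕜 := 𝕜) (analysisOperator 𝕜 f s) (WithLp.toLp 2 a)
    rw [this] at h
    simpa using h
  have h2 : ‖analysisOperator 𝕜 f s‖ ≤ Real.sqrt B * ‖s‖ := by
    refine Real.le_sqrt_of_sq_le ?_ |>.trans_eq
      (by rw [Real.sqrt_mul hf.2.1.le, Real.sqrt_sq (norm_nonneg s)])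
    rw [norm_sq_analysisOperator]
    exact (hf.2.2 s).2
  rw [EuclideanSpace.norm_eq (WithLp.toLp 2 a)] at h1
  set t := Real.sqrt (∑ i, ‖a i‖ ^ 2)
  have ht : 0 ≤ t := Real.sqrt_nonneg _
  rcases (norm_nonneg s).eq_or_lt with h0 | h0
  · rw [← h0]; positivity
  · refine le_of_mul_le_mul_left ?_ h0
    calc ‖s‖ * ‖s‖ = ‖s‖ ^ 2 := (sq _).symm
      _ ≤ ‖analysisOperator 𝕜 f s‖ * t := h1
      _ ≤ Real.sqrt B * ‖s‖ * t := mul_le_mul_of_nonneg_right h2 ht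
      _ = _ := by ring

/-- Write the projection of `a` as the analysis `y` of some `x`. Then `‖y‖² = ⟨x, ∑ aᵢ fᵢ⟩`, and
Cauchy–Schwarz with `A‖x‖² ≤ ‖y‖²` concludes. -/
theorem IsFrame.mul_norm_sq_starProjection_le {f : ι → H} {A B : ℝ} (hf : IsFrame 𝕜 f A B)
    (a : ι → 𝕜) :
    A * ‖(LinearMap.range (analysisOperator 𝕜 f)).starProjection (WithLp.toLp 2 a)‖ ^ 2 ≤
      ‖∑ i, a i • f i‖ ^ 2 := by
  obtain ⟨x, hx⟩ := (LinearMap.range (analysisOperator 𝕜 f)).starProjection_apply_mem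
    (WithLp.toLp 2 a)
  have h1 : inner 𝕜 (analysisOperator 𝕜 f x) (analysisOperator 𝕜 f x) =
      inner 𝕜 x (∑ i, a i • f i) := by
    rw [← inner_analysisOperator_left]
    nth_rewrite 2 [hx]
    rw [← Submodule.inner_starProjection_left_eq_right,
      Submodule.starProjection_eq_self_iff.2 (LinearMap.mem_range_self _ x)]
  rw [← hx]
  set y := analysisOperator 𝕜 f x
  set s := ∑ i, a i • f i
  have h2 : ‖y‖ ^ 2 ≤ ‖x‖ * ‖s‖ := by
    have h := norm_inner_le_norm (𝕜 := 𝕜) x s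
    rw [← h1, inner_self_eq_norm_sq_to_K] at h
    simpa using h
  have h3 : A * ‖x‖ ^ 2 ≤ ‖y‖ ^ 2 := by
    rw [norm_sq_analysisOperator]; exact (hf.2.2 x).1
  rcases (norm_nonneg y).eq_or_lt with h0 | h0
  · rw [← h0]; simp
  · have hy : 0 < ‖y‖ ^ 2 := by positivity
    refine le_of_mul_le_mul_left ?_ hy
    calc ‖y‖ ^ 2 * (A * ‖y‖ ^ 2) = A * (‖y‖ ^ 2) ^ 2 := by ring
      _ ≤ A * (‖x‖ * ‖s‖) ^ 2 :=
        mul_le_mul_of_nonneg_left (pow_le_pow_left₀ hy.le h2 2) hf.1.le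
      _ = A * ‖x‖ ^ 2 * ‖s‖ ^ 2 := by ring
      _ ≤ ‖y‖ ^ 2 * ‖s‖ ^ 2 := mul_le_mul_of_nonneg_right h3 (by positivity)

theorem IsFrame.sum_norm_sq_le [FiniteDimensional 𝕜 H] {f : ι → H} {A B : ℝ}
    (hf : IsFrame 𝕜 f A B) : ∑ i, ‖f i‖ ^ 2 ≤ B * Module.finrank 𝕜 H := by
  let e := stdOrthonormalBasis 𝕜 H
  calc ∑ i, ‖f i‖ ^ 2 = ∑ i, ∑ j, ‖inner 𝕜 (e j) (f i)‖ ^ 2 :=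
        Finset.sum_congr rfl fun i _ => (e.sum_sq_norm_inner_right (f i)).symm
    _ = ∑ j, ∑ i, ‖inner 𝕜 (e j) (f i)‖ ^ 2 := Finset.sum_comm
    _ ≤ ∑ j : Fin (Module.finrank 𝕜 H), B :=
        Finset.sum_le_sum fun j _ => by simpa using (hf.2.2 (e j)).2
    _ = _ := by simp [mul_comm]

/-- The matrix of an orthogonal projection of a coordinate space. -/
theorem exists_matrix_starProjection [DecidableEq ι] (U : Submodule 𝕜 (EuclideanSpace 𝕜 ι)) :
    ∃ P : Matrix ι ι 𝕜, P.IsHermitian ∧ P * P = P ∧ P.trace = Module.finrank 𝕜 U ∧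
      ∀ a : ι → 𝕜, RCLike.re (star a ⬝ᵥ P *ᵥ a) = ‖U.starProjection (WithLp.toLp 2 a)‖ ^ 2 := by
  set P : Matrix ι ι 𝕜 := (toEuclideanCLM (n := ι) (𝕜 := 𝕜)).symm U.starProjection with hPdef
  have hP : toEuclideanCLM (n := ι) (𝕜 := 𝕜) P = U.starProjection := by simp [hPdef]
  refine ⟨P, ?_, ?_, ?_, fun a => ?_⟩
  · refine EquivLike.injective (toEuclideanCLM (n := ι) (𝕜 := 𝕜)) ?_
    rw [← star_eq_conjTranspose, map_star, hP, (isSelfAdjoint_starProjection U).star_eq]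
  · refine EquivLike.injective (toEuclideanCLM (n := ι) (𝕜 := 𝕜)) ?_
    rw [map_mul, hP, U.isIdempotentElem_starProjection.eq]
  · have hproj : LinearMap.IsProj U (U.starProjection : EuclideanSpace 𝕜 ι →ₗ[𝕜] _) :=
      ⟨fun x => U.starProjection_apply_mem x, fun x hx => U.starProjection_eq_self_iff.2 hx⟩
    rw [← hproj.trace, ← hP, coe_toEuclideanCLM_eq_toEuclideanLin,
      toEuclideanLin_eq_toLin_orthonormal, trace_toLin_eq]
  · have h : U.starProjection (WithLp.toLp 2 a) = WithLp.toLp 2 (P *ᵥ a) := by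
      rw [← hP, toEuclideanCLM_toLp]
    have h2 : inner 𝕜 (WithLp.toLp 2 a) (U.starProjection (WithLp.toLp 2 a)) =
        star a ⬝ᵥ P *ᵥ a := by
      rw [h, EuclideanSpace.inner_toLp_toLp, dotProduct_comm]
    rw [← h2, ← U.inner_starProjection_left_eq_right, U.re_inner_starProjection_eq_normSq,
      Submodule.starProjection_apply, Submodule.coe_norm]

end Frame

/-! ### Assembly -/

theorem theorem4p3 :
    ∃ g : ℝ → ℝ → ℝ → ℝ → ℝ → ℝ, (∀ v w x y z : ℝ, 0 < g v w x y z) ∧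
      ∀ (𝕜 : Type*) [RCLike 𝕜] (H : Type*) [NormedAddCommGroup H] [InnerProductSpace 𝕜 H]
        [FiniteDimensional 𝕜 H] (n k : ℕ) (f : Fin k → H) (A B α β ε : ℝ),
        Module.finrank 𝕜 H = n → IsFrame 𝕜 f A B → 0 < α →
        (∀ i, α ≤ ‖f i‖ ∧ ‖f i‖ ≤ β) → 0 < ε → ε < 1 →
        ∃ σ : Finset (Fin k), (1 - ε) * (n : ℝ) ≤ (σ.card : ℝ) ∧
          IsRieszBasisForSpan 𝕜 (fun i : σ => f i) (g ε A B α β) := by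
  -- The summand 1 keeps `g` positive at all real arguments, including those where the roots or
  -- quotients take the default value 0.
  refine ⟨fun ε A B α _ => 1 + Real.sqrt B +
    1 / Real.sqrt (A * restrictionBound ε (B / α ^ 2)), fun _ _ _ _ _ => by positivity, ?_⟩
  intro 𝕜 _ H _ _ _ n k f A B α β ε hn hf hα hnorm hε hε1
  subst hn
  set n := Module.finrank 𝕜 H
  have hA := hf.1
  have hB := hf.2.1
  have hρ0 : 0 < B / α ^ 2 := by positivity
  set U := LinearMap.range (analysisOperator 𝕜 f)
  have hU : Module.finrank 𝕜 U = n :=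
    LinearMap.finrank_range_of_inj hf.injective_analysisOperator
  obtain ⟨P, hP, hPP, htr, hquad⟩ := exists_matrix_starProjection U
  have hk : (Fintype.card (Fin k) : ℝ) ≤ B / α ^ 2 * n := by
    rw [div_mul_eq_mul_div, le_div_iff₀ (by positivity), Fintype.card_fin]
    refine le_trans ?_ hf.sum_norm_sq_le
    calc (k : ℝ) * α ^ 2 = ∑ _i : Fin k, α ^ 2 := by simp
      _ ≤ _ := Finset.sum_le_sum fun i _ => pow_le_pow_left₀ hα.le (hnorm i).1 2
  have hnk : n ≤ Fintype.card (Fin k) := by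
    rw [← hU, ← finrank_euclideanSpace (𝕜 := 𝕜)]
    exact U.finrank_le
  obtain ⟨τ, hτ, hlow⟩ := exists_restriction_bounded_below hP hPP
    (by rw [htr, hU, RCLike.natCast_re]) hnk hk hρ0 hε hε1
  set b := restrictionBound ε (B / α ^ 2)
  have hb : 0 < b := restrictionBound_pos hε hρ0
  refine ⟨τ, hτ, by positivity, fun a => ?_⟩
  obtain ⟨a', ha'τ, ha'⟩ : ∃ a' : Fin k → 𝕜, (∀ i ∉ τ, a' i = 0) ∧ ∀ i : τ, a' i = a i :=
    ⟨fun i => if h : i ∈ τ then a ⟨i, h⟩ else 0, fun i hi => by simp [hi], fun i => by simp⟩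
  have hsq : ∑ i : τ, ‖a i‖ ^ 2 = ∑ i, ‖a' i‖ ^ 2 :=
    Fintype.sum_of_injective (fun i : τ => (i : Fin k)) Subtype.val_injective _ _
      (fun i hi => by simp [ha'τ i (by simpa using hi)]) fun i => by rw [ha']
  have hsum : ∑ i : τ, a i • f i = ∑ i, a' i • f i :=
    Fintype.sum_of_injective (fun i : τ => (i : Fin k)) Subtype.val_injective _ _
      (fun i hi => by simp [ha'τ i (by simpa using hi)]) fun i => by rw [ha']
  rw [hsq, hsum]
  set t := Real.sqrt (∑ i, ‖a' i‖ ^ 2) with ht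
  have ht0 : 0 ≤ t := Real.sqrt_nonneg _
  have htsq : t ^ 2 = ∑ i, ‖a' i‖ ^ 2 := Real.sq_sqrt (by positivity)
  have hAb : 0 < Real.sqrt (A * b) := Real.sqrt_pos.2 (by positivity)
  constructor
  · have h1 := hlow a' ha'τ
    rw [hquad, ← htsq] at h1
    have h2 := hf.mul_norm_sq_starProjection_le a'
    have h3 : Real.sqrt (A * b) * t ≤ ‖∑ i, a' i • f i‖ := by
      refine le_of_sq_le_sq ?_ (norm_nonneg _)
      rw [mul_pow, Real.sq_sqrt (by positivity), mul_assoc]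
      exact (mul_le_mul_of_nonneg_left h1 hA.le).trans h2
    refine le_trans (mul_le_mul_of_nonneg_right ?_ ht0) h3
    rw [one_div_le (by positivity) hAb]
    linarith [Real.sqrt_nonneg B]
  · refine (hf.norm_sum_smul_le a').trans (mul_le_mul_of_nonneg_right ?_ ht0)
    have : 0 ≤ 1 / Real.sqrt (A * b) := by positivity
    linarith
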